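/- **Theorem (diameter bound).** Let $G=(V,w,m)$ be a measured and weighted graph: $V$ is a countable set, $w\colon V\times V\to[0,\infty)$ is symmetric and vanishes on the diagonal, $m\colon V\to(0,\infty)$, for every $x$ the set $\{y : w(x,y)>0\}$ is finite, and $G$ is connected (any two vertices are joined by a finite path along pairs with $w>0$). Put $q(x,y)=w(x,y)/m(x)$, $\operatorname{Deg}(x)=\sum_y q(x,y)$, and assume $\operatorname{Deg}_{\max}:=\sup_x\operatorname{Deg}(x)<\infty$. For $f,g\colon V\to\mathbb R$ let $$\Delta f(x)=\sum_y q(x,y)(f(y)-f(x)),\qquad \Gamma(f,g)=\tfrac12\big(\Delta(fg)-f\Delta g-g\Delta f\big),\qquad \Gamma_2(f,g)=\tfrac12\big(\Delta\Gamma(f,g)-\Gamma(f,\Delta g)-\Gamma(g,\Delta f)\big).$$ Let $P_t=e^{t\Delta}$, $t\ge 0$, be the heat semigroup on $\ell^\infty(V)$ (here $\Delta$ is a bounded operator because $\operatorname{Deg}_{\max}<\infty$), and for $T>0$ and $W\colon V\to[0,\infty)$ let $$k_T(W)=\sup_{j\in\mathbb N}\int_0^T\|P_t(j\wedge W)\|_\infty\,\mathrm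 dt\in[0,\infty].$$ Let $T,K>0$, $n\in(0,\infty]$ and $\rho\colon V\to\mathbb R$. Suppose that $G$ satisfies $CD(\rho,n)$, i.e. for all bounded $f\colon V\to\mathbb R$ and all $x\in V$ $$\Gamma_2(f,f)(x)\ \ge\ \rho(x)\,\Gamma(f,f)(x)+\tfrac1n(\Delta f(x))^2\qquad(\text{with } \tfrac1\infty=0),$$ and that, with $a_-:=-\min\{0,a\}$, $$k_T\big((\rho-K)_-\big)\ \le\ \tfrac14\big(1-e^{-KT/2}\big).$$ Then the diameter $\operatorname{diam}(G)=\sup_{x,y\in V}d(x,y)$ with respect to the combinatorial distance $d$ (the least number of steps of a path from $x$ to $y$ along pairs with $w>0$) is finite, and $$\operatorname{diam}(G)\ \le\ \frac{4\operatorname{Deg}_{\max}e^{KT/2}}{K}.$$ -/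

import Mathlib

open scoped ENNReal NNReal

/-- A measured and weighted graph on the vertex set `V`: symmetric nonnegative edge weights vanishing
on the diagonal, a positive vertex measure; locally finite and connected. -/
structure MWGraph (V : Type*) where
  /-- the edge weights -/
  w : V → V → ℝ
  /-- the vertex measure -/
  m : V → ℝ
  w_nonneg : ∀ x y, 0 ≤ w x y
  w_symm : ∀ x y, w x y = w y x
  w_diag : ∀ x, w x x = 0
  m_pos : ∀ x, 0 < m x
  locallyFinite : ∀ x, {y | 0 < w x y}.Finite
  connected : ∀ x y, Relation.ReflTransGen (fun a b => 0 < w a b) x y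

namespace MWGraph

variable {V : Type*}

/-- The underlying combinatorial graph: `x ∼ y` iff `w x y > 0`. Its distance and diameter are the
combinatorial distance and diameter of the weighted graph. -/
def toSimpleGraph (G : MWGraph V) : SimpleGraph V where
  Adj x y := 0 < G.w x y
  symm := ⟨fun x y h => by rw [G.w_symm y x]; exact h⟩
  loopless := ⟨fun x h => by rw [G.w_diag x] at h; exact lt_irrefl _ h⟩

/-- `q(x,y) = w(x,y) / m(x)`. -/
noncomputable def q (G : MWGraph V) (x y : V) : ℝ := G.w x y / G.m x

/-- `Deg(x) = ∑_y q(x,y)`; the sum is finite by local finiteness. -/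
noncomputable def deg (G : MWGraph V) (x : V) : ℝ := ∑ᶠ y, G.q x y

/-- `Deg_max < ∞`. -/
def BoundedDegree (G : MWGraph V) : Prop := BddAbove (Set.range G.deg)

/-- `Deg_max = sup_x Deg(x)`, used only when the degrees are bounded. -/
noncomputable def degMax (G : MWGraph V) : ℝ := ⨆ x, G.deg x

/-- The Laplacian `Δ f(x) = ∑_y q(x,y) (f(y) - f(x))`; the sum is finite by local finiteness. -/
noncomputable def laplacian (G : MWGraph V) (f : V → ℝ) (x : V) : ℝ :=
  ∑ᶠ y, G.q x y * (f y - f x)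

/-- The carré du champ `Γ(f,g) = ½ (Δ(fg) - f Δg - g Δf)`. -/
noncomputable def Gam (G : MWGraph V) (f g : V → ℝ) (x : V) : ℝ :=
  1 / 2 * (G.laplacian (fun z => f z * g z) x - f x * G.laplacian g x - g x * G.laplacian f x)

/-- `Γ₂(f,g) = ½ (Δ Γ(f,g) - Γ(f,Δg) - Γ(g,Δf))`. -/
noncomputable def Gam2 (G : MWGraph V) (f g : V → ℝ) (x : V) : ℝ :=
  1 / 2 * (G.laplacian (G.Gam f g) x - G.Gam f (G.laplacian g) x - G.Gam g (G.laplacian f) x)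

/-- The variable curvature dimension condition `CD(ρ,n)`, for `n ∈ (0,∞]`: for all bounded `f`,
`Γ₂(f) ≥ ρ Γ(f) + (1/n) (Δ f)²` pointwise, where `1/∞ = 0`. -/
def CD (G : MWGraph V) (ρ : V → ℝ) (n : ℝ≥0∞) : Prop :=
  ∀ f : V → ℝ, (∃ C : ℝ, ∀ x, |f x| ≤ C) → ∀ x,
    ρ x * G.Gam f f x + (n⁻¹).toReal * (G.laplacian f x) ^ 2 ≤ G.Gam2 f f x

theorem q_nonneg (G : MWGraph V) (x y : V) : 0 ≤ G.q x y :=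
  div_nonneg (G.w_nonneg x y) (G.m_pos x).le

theorem support_q_mul (G : MWGraph V) (x : V) (g : V → ℝ) :
    Function.support (fun y => G.q x y * g y) ⊆ ((G.locallyFinite x).toFinset : Set V) := by
  intro y hy
  have h : G.w x y ≠ 0 := by
    intro h0
    exact hy (by simp [q, h0])
  simpa using lt_of_le_of_ne (G.w_nonneg x y) h.symm

theorem finsum_q_mul (G : MWGraph V) (x : V) (g : V → ℝ) :
    ∑ᶠ y, G.q x y * g y = ∑ y ∈ (G.locallyFinite x).toFinset, G.q x y * g y :=
  finsum_eq_sum_of_support_subset _ (G.support_q_mul x g)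

theorem deg_eq_sum (G : MWGraph V) (x : V) :
    G.deg x = ∑ y ∈ (G.locallyFinite x).toFinset, G.q x y := by
  simpa [deg] using G.finsum_q_mul x (fun _ => 1)

theorem laplacian_eq_sum (G : MWGraph V) (f : V → ℝ) (x : V) :
    G.laplacian f x = ∑ y ∈ (G.locallyFinite x).toFinset, G.q x y * (f y - f x) :=
  G.finsum_q_mul x (fun y => f y - f x)

theorem deg_nonneg (G : MWGraph V) (x : V) : 0 ≤ G.deg x := by
  rw [deg_eq_sum]
  exact Finset.sum_nonneg fun y _ => G.q_nonneg x y

theorem degMax_nonneg (G : MWGraph V) : 0 ≤ G.degMax := Real.iSup_nonneg G.deg_nonneg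

theorem abs_laplacian_le (G : MWGraph V) (hG : G.BoundedDegree) (f : V → ℝ) (C : ℝ)
    (hC : ∀ x, |f x| ≤ C) (x : V) : |G.laplacian f x| ≤ 2 * G.degMax * C := by
  have hC0 : 0 ≤ C := (abs_nonneg _).trans (hC x)
  rw [laplacian_eq_sum]
  calc |∑ y ∈ (G.locallyFinite x).toFinset, G.q x y * (f y - f x)|
      ≤ ∑ y ∈ (G.locallyFinite x).toFinset, |G.q x y * (f y - f x)| :=
        Finset.abs_sum_le_sum_abs _ _
    _ ≤ ∑ y ∈ (G.locallyFinite x).toFinset, G.q x y * (2 * C) := by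
        refine Finset.sum_le_sum fun y _ => ?_
        rw [abs_mul, abs_of_nonneg (G.q_nonneg x y)]
        refine mul_le_mul_of_nonneg_left ?_ (G.q_nonneg x y)
        have := abs_sub (f y) (f x)
        linarith [hC x, hC y]
    _ = G.deg x * (2 * C) := by rw [deg_eq_sum, Finset.sum_mul]
    _ ≤ G.degMax * (2 * C) :=
        mul_le_mul_of_nonneg_right (le_ciSup hG x) (by linarith)
    _ = 2 * G.degMax * C := by ring

/-- A bounded function on `V` as an element of `ℓ^∞(V)`. -/
def toLinfty (f : V → ℝ) (C : ℝ) (hC : ∀ x, |f x| ≤ C) : lp (fun _ : V => ℝ) ∞ :=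
  ⟨f, memℓp_infty ⟨C, by rintro _ ⟨x, rfl⟩; exact hC x⟩⟩

/-- The Laplacian of a graph of bounded degree, as a bounded operator on `ℓ^∞(V)`. -/
noncomputable def laplacianCLM (G : MWGraph V) (hG : G.BoundedDegree) :
    lp (fun _ : V => ℝ) ∞ →L[ℝ] lp (fun _ : V => ℝ) ∞ :=
  LinearMap.mkContinuous
    { toFun := fun f => toLinfty (G.laplacian f) (2 * G.degMax * ‖f‖)
        (G.abs_laplacian_le hG f ‖f‖ fun x => lp.norm_apply_le_norm (by simp) f x)
      map_add' := fun f g => by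
        ext x
        change G.laplacian (f + g : lp (fun _ : V => ℝ) ∞) x = G.laplacian f x + G.laplacian g x
        simp only [laplacian_eq_sum, ← Finset.sum_add_distrib, lp.coeFn_add, Pi.add_apply]
        exact Finset.sum_congr rfl fun y _ => by ring
      map_smul' := fun c f => by
        ext x
        change G.laplacian (c • f : lp (fun _ : V => ℝ) ∞) x = c * G.laplacian f x
        simp only [laplacian_eq_sum, Finset.mul_sum, lp.coeFn_smul, Pi.smul_apply, smul_eq_mul]
        exact Finset.sum_congr rfl fun y _ => by ring }
    (2 * G.degMax)
    fun f => lp.norm_le_of_forall_le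
      (mul_nonneg (mul_nonneg zero_le_two G.degMax_nonneg) (norm_nonneg f))
      (G.abs_laplacian_le hG f ‖f‖ fun x => lp.norm_apply_le_norm (by simp) f x)

/-- The heat semigroup `P_t = e^{tΔ}` on `ℓ^∞(V)`. For bounded degree `Δ` is a bounded operator,
so the semigroup it generates is given by the exponential series. -/
noncomputable def heat (G : MWGraph V) (hG : G.BoundedDegree) (t : ℝ) :
    lp (fun _ : V => ℝ) ∞ →L[ℝ] lp (fun _ : V => ℝ) ∞ :=
  NormedSpace.exp (t • G.laplacianCLM hG)

/-- The truncation `n ∧ W` of a nonnegative function, as an element of `ℓ^∞(V)`. -/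
noncomputable def trunc (n : ℕ) (W : V → ℝ≥0) : lp (fun _ : V => ℝ) ∞ :=
  toLinfty (fun x => min (n : ℝ) (W x)) n fun x => by
    rw [abs_of_nonneg (le_min n.cast_nonneg (W x).coe_nonneg)]
    exact min_le_left _ _

/-- `k_T(W) = sup_n ∫_0^T ‖P_t (n ∧ W)‖_∞ dt ∈ [0,∞]`. -/
noncomputable def katoConst (G : MWGraph V) (hG : G.BoundedDegree) (T : ℝ) (W : V → ℝ≥0) : ℝ≥0∞ :=
  ⨆ n : ℕ, ∫⁻ t in Set.Ioc 0 T, ‖G.heat hG t (trunc n W)‖ₑ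

end MWGraph

/-!
The argument is a heat flow interpolation. Along the semigroup, `Γ(P_s f)` solves
`∂_s Γ(P_s f) = Δ Γ(P_s f) - 2 Γ₂(P_s f)`, so a curvature bound `Γ₂ ≥ (K - v) Γ` turns
`e^{2Ks} Γ(P_s f)` into a subsolution of the heat equation with potential `2v`. By Duhamel's
principle its supremum `M` over `[0, T]` satisfies `M ≤ ‖Γ f‖ + 2M ∫₀ᵀ ‖P_s v‖ ds`, and a small
Kato constant lets us absorb the last term. The semigroup property then gives
`‖Γ(P_t f)‖ ≤ e^{K(T - t)} ‖Γ f‖` for all `t ≥ 0`.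

Consequently `P_t f` becomes constant as `t → ∞`, while `|Δ P_t f| ≤ (2 Deg_max Γ(P_t f))^{1/2}`
decays exponentially, so that the flow moves `f` only by a bounded amount. Taking for `f` a
truncated distance function bounds the diameter. The possibly unbounded potential `(ρ - K)₋` may be
truncated because bounded degree forces the curvature to be at least `-Deg_max`.
-/

open Filter NormedSpace Set Topology
open scoped lp

section BanachSpace

variable {E : Type*} [NormedAddCommGroup E] [NormedSpace ℝ E]

theorem norm_sub_le_div_of_norm_deriv_le_exp {F F' : ℝ → E} {c k t : ℝ} (hc : 0 ≤ c) (hk : 0 < k)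
    (hF : ∀ s, 0 ≤ s → HasDerivAt F (F' s) s)
    (hF' : ∀ s, 0 ≤ s → ‖F' s‖ ≤ c * Real.exp (-(k * s))) (ht : 0 ≤ t) :
    ‖F t - F 0‖ ≤ c / k := by
  have hB (s : ℝ) : HasDerivAt (fun s => c / k * (1 - Real.exp (-(k * s))))
      (c * Real.exp (-(k * s))) s := by
    have hexp : HasDerivAt (fun s => Real.exp (-(k * s))) (Real.exp (-(k * s)) * -k) s := by
      simpa using ((hasDerivAt_id s).const_mul k).neg.exp
    refine ((hexp.const_sub 1).const_mul (c / k)).congr_deriv ?_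
    field_simp
  have hle : ‖F t - F 0‖ ≤ c / k * (1 - Real.exp (-(k * t))) :=
    image_norm_le_of_norm_deriv_right_le_deriv_boundary (f := fun s => F s - F 0)
      (fun s hs => ((hF s hs.1).sub_const _).continuousAt.continuousWithinAt)
      (fun s hs => ((hF s hs.1).sub_const _).hasDerivWithinAt) (by simp) hB
      (fun s hs => hF' s hs.1) (right_mem_Icc.2 ht)
  refine hle.trans (mul_le_of_le_one_right (by positivity) ?_)
  linarith [Real.exp_pos (-(k * t))]

theorem exp_zero_smul (A : E →L[ℝ] E) : exp ((0 : ℝ) • A) = 1 := by rw [zero_smul, exp_zero]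

variable [CompleteSpace E]

theorem exp_apply_eq_self {A : E →L[ℝ] E} {f : E} (hf : A f = 0) : exp A f = f := by
  have hsum := (exp_series_hasSum_exp' (𝕂 := ℝ) A).mapL (ContinuousLinearMap.apply ℝ E f)
  refine hsum.unique ?_
  convert hasSum_single 0 fun k hk => ?_ using 1
  · simp
  · obtain ⟨k, rfl⟩ := Nat.exists_eq_succ_of_ne_zero hk
    simp [pow_succ, hf]

theorem exp_add_smul (A : E →L[ℝ] E) (s t : ℝ) :
    exp ((s + t) • A) = exp (s • A) * exp (t • A) := by
  let _ : NormedAlgebra ℚ (E →L[ℝ] E) := NormedAlgebra.restrictScalars ℚ ℝ _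
  rw [add_smul]
  exact exp_add_of_commute (((Commute.refl A).smul_left s).smul_right t)

theorem exp_sub_smul_one (A : E →L[ℝ] E) (c : ℝ) :
    exp (A - c • (1 : E →L[ℝ] E)) = Real.exp (-c) • exp A := by
  let _ : NormedAlgebra ℚ (E →L[ℝ] E) := NormedAlgebra.restrictScalars ℚ ℝ _
  have hsub : A - c • (1 : E →L[ℝ] E) = algebraMap ℝ (E →L[ℝ] E) (-c) + A := by
    rw [Algebra.algebraMap_eq_smul_one, neg_smul, sub_eq_neg_add]
  rw [hsub, exp_add_of_commute (Algebra.commutes _ _), ← algebraMap_exp_comm,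
    Real.exp_eq_exp_ℝ, ← Algebra.smul_def]

theorem exp_apply_mem {C : ProperCone ℝ E} {A : E →L[ℝ] E} (hA : ∀ f ∈ C, A f ∈ C) {f : E}
    (hf : f ∈ C) : exp A f ∈ C := by
  have hpow (k : ℕ) : (A ^ k) f ∈ C := by
    induction k with
    | zero => simpa using hf
    | succ k ih =>
      rw [pow_succ']
      exact hA _ ih
  have hsum := (exp_series_hasSum_exp' (𝕂 := ℝ) A).mapL (ContinuousLinearMap.apply ℝ E f)
  exact C.isClosed.mem_of_tendsto hsum <| .of_forall fun s =>
    sum_mem fun k _ => C.smul_mem (hpow k) (by positivity)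

theorem exp_smul_apply_mem_of_add_smul_mem {C : ProperCone ℝ E} {A : E →L[ℝ] E} {c t : ℝ}
    (hA : ∀ f ∈ C, A f + c • f ∈ C) (ht : 0 ≤ t) {f : E} (hf : f ∈ C) : exp (t • A) f ∈ C := by
  have hshift : t • A = t • (A + c • (1 : E →L[ℝ] E)) - (t * c) • (1 : E →L[ℝ] E) := by
    rw [smul_add, smul_smul, add_sub_cancel_right]
  rw [hshift, exp_sub_smul_one]
  exact C.smul_mem (exp_apply_mem (fun g hg => C.smul_mem (hA g hg) ht) hf) (Real.exp_pos _).le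

end BanachSpace

theorem le_div_one_sub_of_forall_le_add_mul {φ : ℝ → ℝ} {T a c : ℝ} (hφ : ContinuousOn φ (Icc 0 T))
    (hc : c < 1)
    (h : ∀ t ∈ Icc 0 T, ∀ M, (∀ s ∈ Icc 0 t, φ s ≤ M) → φ t ≤ a + c * M) {t : ℝ}
    (ht : t ∈ Icc 0 T) : φ t ≤ a / (1 - c) := by
  obtain ⟨r, hr, hmax⟩ := isCompact_Icc.exists_isMaxOn ⟨t, ht⟩ hφ
  have hself : φ r ≤ a + c * φ r := h r hr (φ r) fun s hs => hmax ⟨hs.1, hs.2.trans hr.2⟩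
  calc φ t ≤ φ r := hmax ht
    _ ≤ a / (1 - c) := by
      rw [le_div_iff₀ (by linarith)]
      linarith

theorem semigroup_le_exp_mul {α : Type*} {S : ℝ → α → α}
    (hS : ∀ s t x, S (s + t) x = S s (S t x)) {N : α → ℝ} (hN : ∀ x, 0 ≤ N x) {K T : ℝ}
    (hK : 0 ≤ K) (hT : 0 < T)
    (h : ∀ x, ∀ t ∈ Icc 0 T, N (S t x) ≤ Real.exp (K * (T - 2 * t)) * N x) (x : α) {t : ℝ}
    (ht : 0 ≤ t) : N (S t x) ≤ Real.exp (K * (T - t)) * N x := by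
  suffices hind : ∀ (k : ℕ) (x : α) (t : ℝ), 0 ≤ t → t ≤ k * T →
      N (S t x) ≤ Real.exp (K * (T - t)) * N x by
    obtain ⟨k, hk⟩ := exists_nat_ge (t / T)
    exact hind k x t ht ((div_le_iff₀ hT).1 hk)
  have hshort (x : α) (t : ℝ) (ht : t ∈ Icc 0 T) : N (S t x) ≤ Real.exp (K * (T - t)) * N x := by
    refine (h x t ht).trans (mul_le_mul_of_nonneg_right ?_ (hN x))
    gcongr
    linarith [ht.1]
  intro k
  induction k with
  | zero => exact fun x t ht htk => hshort x t ⟨ht, htk.trans (by simpa using hT.le)⟩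
  | succ k ih =>
    intro x t ht htk
    rcases le_total t T with htT | hTt
    · exact hshort x t ⟨ht, htT⟩
    have hprev : t - T ≤ k * T := by
      push_cast at htk
      linarith
    calc N (S t x) = N (S (t - T) (S T x)) := by rw [← hS, sub_add_cancel]
      _ ≤ Real.exp (K * (T - (t - T))) * N (S T x) := ih (S T x) _ (by linarith) hprev
      _ ≤ Real.exp (K * (T - (t - T))) * (Real.exp (K * (T - 2 * T)) * N x) := by
        gcongr
        exact h x T (right_mem_Icc.2 hT.le)
      _ = Real.exp (K * (T - t)) * N x := by
        rw [← mul_assoc, ← Real.exp_add]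
        ring_nf

theorem abs_min_dist_sub_min_dist_le_one {V : Type*} {H : SimpleGraph V} {x y : V}
    (h : H.Adj x y) (x₀ : V) (N : ℕ) :
    |((min (H.dist x₀ y) N : ℕ) : ℝ) - (min (H.dist x₀ x) N : ℕ)| ≤ 1 := by
  have hdist := h.diff_dist_adj (u := x₀)
  rw [abs_sub_le_iff, sub_le_iff_le_add, sub_le_iff_le_add]
  constructor <;> norm_cast <;> omega

theorem ediam_ne_top_and_diam_le_of_dist_le {V : Type*} {H : SimpleGraph V} (hH : H.Preconnected)
    {r : ℝ} (hr : 0 ≤ r) (h : ∀ x y, (H.dist x y : ℝ) ≤ r) :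
    H.ediam ≠ ⊤ ∧ (H.diam : ℝ) ≤ r := by
  have hediam : H.ediam ≤ (⌊r⌋₊ : ℕ) := SimpleGraph.ediam_le_of_edist_le fun x y => by
    rw [← (hH x y).coe_dist_eq_edist]
    exact_mod_cast Nat.le_floor (h x y)
  exact ⟨ne_top_of_le_ne_top (ENat.natCast_ne_top _) hediam,
    (Nat.cast_le.2 (ENat.toNat_le_of_le_natCast hediam)).trans (Nat.floor_le hr)⟩

namespace MWGraph

variable {V : Type*} (G : MWGraph V)

theorem preconnected_toSimpleGraph : G.toSimpleGraph.Preconnected := fun x y =>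
  (SimpleGraph.reachable_iff_reflTransGen x y).2 (G.connected x y)

/-! ### The carré du champ and curvature -/

theorem two_mul_Gam_eq_sum (f g : V → ℝ) (x : V) :
    2 * G.Gam f g x =
      ∑ y ∈ (G.locallyFinite x).toFinset, G.q x y * ((f y - f x) * (g y - g x)) := by
  simp only [Gam, laplacian_eq_sum, Finset.mul_sum, ← Finset.sum_sub_distrib]
  exact Finset.sum_congr rfl fun y _ => by ring

theorem Gam_self_nonneg (f : V → ℝ) (x : V) : 0 ≤ G.Gam f f x := by
  have hsum : 0 ≤ 2 * G.Gam f f x := by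
    rw [two_mul_Gam_eq_sum]
    exact Finset.sum_nonneg fun y _ => mul_nonneg (G.q_nonneg x y) (mul_self_nonneg _)
  linarith

theorem laplacian_sq_le_deg_mul_Gam (f : V → ℝ) (x : V) :
    G.laplacian f x ^ 2 ≤ G.deg x * (2 * G.Gam f f x) := by
  rw [laplacian_eq_sum, deg_eq_sum, two_mul_Gam_eq_sum]
  exact Finset.sum_sq_le_sum_mul_sum_of_sq_le_mul _ (fun y _ => G.q_nonneg x y)
    (fun y _ => mul_nonneg (G.q_nonneg x y) (mul_self_nonneg _)) fun y _ => le_of_eq (by ring)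

theorem q_mul_sub_sq_le_Gam (f : V → ℝ) {x y : V} (h : 0 < G.w x y) :
    G.q x y * (f y - f x) ^ 2 ≤ 2 * G.Gam f f x := by
  rw [two_mul_Gam_eq_sum, pow_two]
  exact Finset.single_le_sum (f := fun y => G.q x y * ((f y - f x) * (f y - f x)))
    (fun z _ => mul_nonneg (G.q_nonneg x z) (mul_self_nonneg _)) (by simpa using h)

theorem Gam_self_le_deg_div_two {f : V → ℝ} (hf : ∀ x y, 0 < G.w x y → |f y - f x| ≤ 1) (x : V) :
    G.Gam f f x ≤ G.deg x / 2 := by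
  rw [le_div_iff₀' two_pos, two_mul_Gam_eq_sum, deg_eq_sum]
  refine Finset.sum_le_sum fun y hy => mul_le_of_le_one_right (G.q_nonneg x y) ?_
  rw [← pow_two, sq_le_one_iff_abs_le_one]
  exact hf x y (by simpa using hy)

theorem tendsto_sub_of_tendsto_Gam {ι : Type*} {l : Filter ι} {g : ι → V → ℝ}
    (h : ∀ x, Tendsto (fun t => G.Gam (g t) (g t) x) l (𝓝 0)) (x y : V) :
    Tendsto (fun t => g t y - g t x) l (𝓝 0) := by
  induction G.connected x y with
  | refl => simpa using tendsto_const_nhds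
  | @tail b c _ hbc ih =>
    have hq : 0 < G.q b c := div_pos hbc (G.m_pos b)
    have hbound : Tendsto (fun t => 2 * G.Gam (g t) (g t) b / G.q b c) l (𝓝 0) := by
      simpa using ((h b).const_mul 2).div_const (G.q b c)
    have hsq : Tendsto (fun t => (g t c - g t b) ^ 2) l (𝓝 0) :=
      squeeze_zero (fun t => sq_nonneg _)
        (fun t => (le_div_iff₀' hq).2 (G.q_mul_sub_sq_le_Gam (g t) hbc)) hbound
    have hedge : Tendsto (fun t => g t c - g t b) l (𝓝 0) := by
      rw [tendsto_zero_iff_abs_tendsto_zero]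
      simpa [Function.comp_def, Real.sqrt_sq_eq_abs] using
        (Real.continuous_sqrt.tendsto 0).comp hsq
    simpa using hedge.add ih

theorem two_mul_Gam2_self_eq_sum (f : V → ℝ) (x : V) :
    2 * G.Gam2 f f x = ∑ y ∈ (G.locallyFinite x).toFinset,
        G.q x y * (G.Gam f f y - (f y - f x) * G.laplacian f y)
      - G.deg x * G.Gam f f x + G.laplacian f x ^ 2 := by
  have hsq : G.laplacian f x ^ 2 =
      ∑ y ∈ (G.locallyFinite x).toFinset, G.q x y * (f y - f x) * G.laplacian f x := by
    rw [← Finset.sum_mul, ← laplacian_eq_sum, pow_two]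
  have hGam2 : 2 * G.Gam2 f f x =
      G.laplacian (G.Gam f f) x - 2 * G.Gam f (G.laplacian f) x := by
    rw [Gam2]
    ring
  rw [hGam2, two_mul_Gam_eq_sum, laplacian_eq_sum, hsq, deg_eq_sum, Finset.sum_mul,
    ← Finset.sum_sub_distrib, ← Finset.sum_sub_distrib, ← Finset.sum_add_distrib]
  exact Finset.sum_congr rfl fun y _ => by ring

theorem two_mul_Gam_laplacian_self (f : V → ℝ) (x : V) :
    2 * G.Gam f (G.laplacian f) x = G.laplacian (G.Gam f f) x - 2 * G.Gam2 f f x := by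
  rw [Gam2]
  ring

variable {G} in
theorem cd_top_iff {ρ : V → ℝ} :
    G.CD ρ ∞ ↔ ∀ f : V → ℝ, (∃ C : ℝ, ∀ x, |f x| ≤ C) → ∀ x,
      ρ x * G.Gam f f x ≤ G.Gam2 f f x := by
  simp [CD]

variable {G} in
theorem CD.top {ρ : V → ℝ} {n : ℝ≥0∞} (h : G.CD ρ n) : G.CD ρ ∞ :=
  cd_top_iff.2 fun f hf x => (h f hf x).trans' <|
    le_add_of_nonneg_right (mul_nonneg ENNReal.toReal_nonneg (sq_nonneg _))

variable {G} in
theorem CD.anti {ρ ρ' : V → ℝ} {n : ℝ≥0∞} (h : G.CD ρ n) (hρ : ρ' ≤ ρ) : G.CD ρ' n :=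
  fun f hf x => (h f hf x).trans' <| by
    gcongr
    exacts [G.Gam_self_nonneg f x, hρ x]

variable {G} in
theorem CD.sup {ρ ρ' : V → ℝ} {n : ℝ≥0∞} (h : G.CD ρ n) (h' : G.CD ρ' n) :
    G.CD (ρ ⊔ ρ') n := fun f hf x => by
  rcases le_total (ρ x) (ρ' x) with hle | hle
  · simpa [hle] using h' f hf x
  · simpa [hle] using h f hf x

theorem deg_le_degMax (hG : G.BoundedDegree) (x : V) : G.deg x ≤ G.degMax := le_ciSup hG x

theorem laplacian_sq_le_degMax_mul_Gam (hG : G.BoundedDegree) (f : V → ℝ) (x : V) :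
    G.laplacian f x ^ 2 ≤ 2 * G.degMax * G.Gam f f x := by
  have hdeg := mul_le_mul_of_nonneg_right (G.deg_le_degMax hG x) (G.Gam_self_nonneg f x)
  linarith [G.laplacian_sq_le_deg_mul_Gam f x]

theorem mul_laplacian_le (hG : G.BoundedDegree) (f : V → ℝ) (x : V) (a : ℝ) :
    a * G.laplacian f x ≤ G.degMax / 2 * a ^ 2 + G.Gam f f x := by
  have hΓ := G.Gam_self_nonneg f x
  have hD := G.degMax_nonneg
  refine le_of_sq_le_sq ?_ (by positivity)
  calc (a * G.laplacian f x) ^ 2 = a ^ 2 * G.laplacian f x ^ 2 := mul_pow _ _ _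
    _ ≤ a ^ 2 * (2 * G.degMax * G.Gam f f x) := by
      gcongr
      exact G.laplacian_sq_le_degMax_mul_Gam hG f x
    _ ≤ (G.degMax / 2 * a ^ 2 + G.Gam f f x) ^ 2 := by
      linarith [sq_nonneg (G.degMax / 2 * a ^ 2 - G.Gam f f x)]

theorem cd_neg_degMax (hG : G.BoundedDegree) : G.CD (fun _ => -G.degMax) ∞ := by
  refine cd_top_iff.2 fun f _ x => ?_
  have hsum : -(G.degMax / 2) * (2 * G.Gam f f x) ≤ ∑ y ∈ (G.locallyFinite x).toFinset,
      G.q x y * (G.Gam f f y - (f y - f x) * G.laplacian f y) := by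
    rw [two_mul_Gam_eq_sum, Finset.mul_sum]
    refine Finset.sum_le_sum fun y _ => ?_
    rw [mul_left_comm]
    refine mul_le_mul_of_nonneg_left ?_ (G.q_nonneg x y)
    linarith [G.mul_laplacian_le hG f y (f y - f x)]
  have hdeg := mul_le_mul_of_nonneg_right (G.deg_le_degMax hG x) (G.Gam_self_nonneg f x)
  linarith [G.two_mul_Gam2_self_eq_sum f x, sq_nonneg (G.laplacian f x)]

variable {G} in
theorem CD.sub_trunc {ρ : V → ℝ} {n : ℝ≥0∞} (h : G.CD ρ n) (hG : G.BoundedDegree) {K : ℝ}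
    {W : V → ℝ≥0} (hW : ∀ x, K - W x ≤ ρ x) {j : ℕ} (hj : G.degMax + K ≤ j) :
    G.CD (fun x => K - trunc j W x) ∞ := by
  refine (h.top.sup (G.cd_neg_degMax hG)).anti fun x => ?_
  change K - min (j : ℝ) (W x) ≤ max (ρ x) (-G.degMax)
  rcases le_total (j : ℝ) (W x) with hle | hle
  · rw [min_eq_left hle]
    exact le_max_of_le_right (by linarith)
  · rw [min_eq_right hle]
    exact le_max_of_le_left (hW x)

/-! ### The heat semigroup -/

theorem abs_apply_le_norm (f : ℓ^∞(V, ℝ)) (x : V) : |f x| ≤ ‖f‖ :=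
  lp.norm_apply_le_norm (by simp) f x

theorem apply_le_norm (f : ℓ^∞(V, ℝ)) (x : V) : f x ≤ ‖f‖ :=
  (le_abs_self _).trans (abs_apply_le_norm f x)

variable (hG : G.BoundedDegree)

theorem laplacianCLM_apply (f : ℓ^∞(V, ℝ)) (x : V) :
    G.laplacianCLM hG f x = G.laplacian f x := rfl

theorem laplacianCLM_one : G.laplacianCLM hG 1 = 0 := by
  ext x
  simp [laplacianCLM_apply, laplacian_eq_sum]

theorem hasDerivAt_heat (t : ℝ) :
    HasDerivAt (G.heat hG) (G.heat hG t * G.laplacianCLM hG) t :=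
  hasDerivAt_exp_smul_const (G.laplacianCLM hG) t

theorem hasDerivAt_heat_apply (f : ℓ^∞(V, ℝ)) (t : ℝ) :
    HasDerivAt (fun s => G.heat hG s f) (G.laplacianCLM hG (G.heat hG t f)) t := by
  have hheat : HasDerivAt (G.heat hG) (G.laplacianCLM hG * G.heat hG t) t :=
    hasDerivAt_exp_smul_const' (G.laplacianCLM hG) t
  simpa using hheat.clm_apply (hasDerivAt_const t f)

theorem continuous_heat : Continuous (G.heat hG) :=
  continuous_iff_continuousAt.2 fun t => (G.hasDerivAt_heat hG t).continuousAt

theorem heat_zero : G.heat hG 0 = 1 :=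
  exp_zero_smul _

theorem heat_add_apply (s t : ℝ) (f : ℓ^∞(V, ℝ)) :
    G.heat hG (s + t) f = G.heat hG s (G.heat hG t f) :=
  DFunLike.congr_fun (exp_add_smul (G.laplacianCLM hG) s t) f

theorem heat_one (t : ℝ) : G.heat hG t 1 = 1 :=
  exp_apply_eq_self (by simp [laplacianCLM_one])

/-- The closed cone of nonnegative functions, which expresses that the heat semigroup is positivity
preserving: `lp` carries no order in Mathlib. -/
noncomputable def nonnegCone (V : Type*) : ProperCone ℝ ℓ^∞(V, ℝ) :=
  ⨅ x, (ProperCone.positive ℝ ℝ).comap (lp.evalCLM ℝ (fun _ : V => ℝ) ∞ x)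

theorem mem_nonnegCone {f : ℓ^∞(V, ℝ)} : f ∈ nonnegCone V ↔ ∀ x, 0 ≤ f x := by
  simp only [nonnegCone, ClosedSubmodule.mem_iInf, ClosedSubmodule.mem_comap,
    ContinuousLinearMap.coe_restrictScalars', ProperCone.mem_positive]
  rfl

theorem laplacian_add_degMax_mul_nonneg {f : V → ℝ} (hG : G.BoundedDegree) (hf : ∀ x, 0 ≤ f x)
    (x : V) :
    0 ≤ G.laplacian f x + G.degMax * f x := by
  have hsplit : G.laplacian f x =
      ∑ y ∈ (G.locallyFinite x).toFinset, G.q x y * f y - G.deg x * f x := by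
    rw [laplacian_eq_sum, deg_eq_sum, Finset.sum_mul, ← Finset.sum_sub_distrib]
    exact Finset.sum_congr rfl fun y _ => by ring
  have hsum : 0 ≤ ∑ y ∈ (G.locallyFinite x).toFinset, G.q x y * f y :=
    Finset.sum_nonneg fun y _ => mul_nonneg (G.q_nonneg x y) (hf y)
  have hdeg := mul_le_mul_of_nonneg_right (G.deg_le_degMax hG x) (hf x)
  linarith

variable {t : ℝ}

theorem heat_apply_mem_nonnegCone (ht : 0 ≤ t) {f : ℓ^∞(V, ℝ)} (hf : f ∈ nonnegCone V) :
    G.heat hG t f ∈ nonnegCone V :=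
  exp_smul_apply_mem_of_add_smul_mem (A := G.laplacianCLM hG) (c := G.degMax)
    (fun _ hg => mem_nonnegCone.2 (G.laplacian_add_degMax_mul_nonneg hG (mem_nonnegCone.1 hg)))
    ht hf

theorem heat_apply_mono (ht : 0 ≤ t) {f g : ℓ^∞(V, ℝ)} (hfg : ∀ x, f x ≤ g x) (x : V) :
    G.heat hG t f x ≤ G.heat hG t g x := by
  have hsub : g - f ∈ nonnegCone V := mem_nonnegCone.2 fun y => sub_nonneg.2 (hfg y)
  have hmem := G.heat_apply_mem_nonnegCone hG ht hsub
  rw [map_sub] at hmem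
  exact sub_nonneg.1 (mem_nonnegCone.1 hmem x)

theorem heat_apply_le_norm (ht : 0 ≤ t) (f : ℓ^∞(V, ℝ)) (x : V) : G.heat hG t f x ≤ ‖f‖ := by
  have hle : ∀ y, f y ≤ (‖f‖ • (1 : ℓ^∞(V, ℝ))) y := fun y => by simpa using apply_le_norm f y
  simpa [heat_one] using G.heat_apply_mono hG ht hle x

/-- Integrate the derivative of `s ↦ P_{t-s} (w s) x` over `[0, t]` (the Duhamel formula). -/
theorem apply_le_heat_apply_add_integral {w w' g : ℝ → ℓ^∞(V, ℝ)} (ht : 0 ≤ t)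
    (hw : ∀ s, HasDerivAt w (w' s) s) (hg : Continuous g)
    (hle : ∀ s ∈ Ioo 0 t, ∀ y, w' s y ≤ G.laplacian (w s) y + g s y) (x : V) :
    w t x ≤ G.heat hG t (w 0) x + ∫ s in (0 : ℝ)..t, G.heat hG (t - s) (g s) x := by
  have hderiv (s : ℝ) : HasDerivAt (fun s => G.heat hG (t - s) (w s) x)
      (G.heat hG (t - s) (w' s - G.laplacianCLM hG (w s)) x) s := by
    have hflow := ((G.hasDerivAt_heat hG (t - s)).comp_const_sub t s).clm_apply (hw s)
    refine ((lp.evalCLM ℝ (fun _ : V => ℝ) ∞ x).hasFDerivAt.comp_hasDerivAt s hflow).congr_deriv ?_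
    rw [map_sub, sub_eq_neg_add (G.heat hG (t - s) (w' s))]
    rfl
  have hbound : ∀ s ∈ Ioo 0 t, G.heat hG (t - s) (w' s - G.laplacianCLM hG (w s)) x ≤
      G.heat hG (t - s) (g s) x := fun s hs =>
    G.heat_apply_mono hG (sub_nonneg.2 hs.2.le) (fun y => sub_le_iff_le_add'.2 (hle s hs y)) x
  have hcont : Continuous fun s => G.heat hG (t - s) (g s) x :=
    (lp.evalCLM ℝ (fun _ : V => ℝ) ∞ x).continuous.comp
      (((G.continuous_heat hG).comp (continuous_sub_left t)).clm_apply hg)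
  have hintegral := intervalIntegral.sub_le_integral_of_hasDeriv_right_of_le ht
    (fun s _ => (hderiv s).continuousAt.continuousWithinAt)
    (fun s _ => (hderiv s).hasDerivWithinAt) hcont.integrableOn_Icc hbound
  simp only [sub_self, sub_zero, heat_zero, one_apply_eq_self] at hintegral
  linarith

/-! ### Gradient decay along the heat semigroup -/

/-- The carré du champ `Γ(f, g)` of bounded functions, as an element of `ℓ^∞(V)`; it is built from
`laplacianCLM` so that it can be differentiated along curves in `ℓ^∞(V)`. -/
noncomputable def carreDuChamp (f g : ℓ^∞(V, ℝ)) : ℓ^∞(V, ℝ) :=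
  (1 / 2 : ℝ) • (G.laplacianCLM hG (f * g) - f * G.laplacianCLM hG g - g * G.laplacianCLM hG f)

theorem carreDuChamp_apply (f g : ℓ^∞(V, ℝ)) (x : V) :
    G.carreDuChamp hG f g x = G.Gam f g x := rfl

theorem carreDuChamp_comm (f g : ℓ^∞(V, ℝ)) :
    G.carreDuChamp hG f g = G.carreDuChamp hG g f := by
  simp only [carreDuChamp, mul_comm f g, sub_right_comm]

theorem norm_carreDuChamp_self_le {f : ℓ^∞(V, ℝ)} {C : ℝ} (hC : 0 ≤ C)
    (hf : ∀ x, G.Gam f f x ≤ C) : ‖G.carreDuChamp hG f f‖ ≤ C :=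
  lp.norm_le_of_forall_le hC fun x => by
    rw [carreDuChamp_apply, Real.norm_of_nonneg (G.Gam_self_nonneg f x)]
    exact hf x

theorem norm_laplacianCLM_le_sqrt (f : ℓ^∞(V, ℝ)) :
    ‖G.laplacianCLM hG f‖ ≤ √(2 * G.degMax * ‖G.carreDuChamp hG f f‖) :=
  lp.norm_le_of_forall_le (Real.sqrt_nonneg _) fun x => Real.abs_le_sqrt <| by
    refine (G.laplacian_sq_le_degMax_mul_Gam hG f x).trans ?_
    have hD := G.degMax_nonneg
    gcongr
    exact apply_le_norm (G.carreDuChamp hG f f) x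

theorem hasDerivAt_carreDuChamp {f g : ℝ → ℓ^∞(V, ℝ)} {f' g' : ℓ^∞(V, ℝ)}
    (hf : HasDerivAt f f' t) (hg : HasDerivAt g g' t) :
    HasDerivAt (fun s => G.carreDuChamp hG (f s) (g s))
      (G.carreDuChamp hG f' (g t) + G.carreDuChamp hG (f t) g') t := by
  set L := G.laplacianCLM hG
  have hL {u : ℝ → ℓ^∞(V, ℝ)} {u' : ℓ^∞(V, ℝ)} (hu : HasDerivAt u u' t) :
      HasDerivAt (fun s => L (u s)) (L u') t := L.hasFDerivAt.comp_hasDerivAt t hu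
  refine ((((hL (hf.mul hg)).sub (hf.mul (hL hg))).sub (hg.mul (hL hf))).const_smul
    (1 / 2 : ℝ)).congr_deriv ?_
  rw [carreDuChamp, carreDuChamp, ← smul_add, map_add]
  congr 1
  ring

theorem hasDerivAt_carreDuChamp_heat (f : ℓ^∞(V, ℝ)) (t : ℝ) :
    HasDerivAt (fun s => G.carreDuChamp hG (G.heat hG s f) (G.heat hG s f))
      ((2 : ℝ) • G.carreDuChamp hG (G.heat hG t f) (G.laplacianCLM hG (G.heat hG t f))) t := by
  have hheat := G.hasDerivAt_heat_apply hG f t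
  refine (G.hasDerivAt_carreDuChamp hG hheat hheat).congr_deriv ?_
  rw [carreDuChamp_comm, two_smul]

theorem continuous_norm_heat_apply (f : ℓ^∞(V, ℝ)) : Continuous fun s => ‖G.heat hG s f‖ :=
  ((G.continuous_heat hG).clm_apply continuous_const).norm

theorem continuous_norm_carreDuChamp_heat (f : ℓ^∞(V, ℝ)) :
    Continuous fun s => ‖G.carreDuChamp hG (G.heat hG s f) (G.heat hG s f)‖ :=
  (continuous_iff_continuousAt.2 fun t =>
    (G.hasDerivAt_carreDuChamp_heat hG f t).continuousAt).norm

/-- `G.HasGradientDecay hG A K` is the gradient estimate `‖Γ(P_t f)‖ ≤ A e^{-Kt} ‖Γ f‖` in `ℓ^∞(V)`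
for all bounded `f` and all times `t ≥ 0`. -/
def HasGradientDecay (A K : ℝ) : Prop :=
  ∀ (f : ℓ^∞(V, ℝ)) (t : ℝ), 0 ≤ t →
    ‖G.carreDuChamp hG (G.heat hG t f) (G.heat hG t f)‖ ≤
      A * Real.exp (-(K * t)) * ‖G.carreDuChamp hG f f‖

section Kato

variable {K T β : ℝ}

theorem two_mul_Gam_laplacian_self_add_le {v : V → ℝ} (hCD : G.CD (fun x => K - v x) ∞)
    (f : ℓ^∞(V, ℝ)) (x : V) :
    2 * G.Gam f (G.laplacian f) x + 2 * K * G.Gam f f x ≤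
      G.laplacian (G.Gam f f) x + 2 * v x * G.Gam f f x := by
  have hΓ₂ := cd_top_iff.1 hCD f ⟨‖f‖, abs_apply_le_norm f⟩ x
  linarith [G.two_mul_Gam_laplacian_self f x]

theorem hasDerivAt_exp_smul_carreDuChamp_heat (K : ℝ) (f : ℓ^∞(V, ℝ)) (t : ℝ) :
    HasDerivAt
      (fun s => Real.exp (2 * K * s) • G.carreDuChamp hG (G.heat hG s f) (G.heat hG s f))
      (Real.exp (2 * K * t) •
        ((2 : ℝ) • G.carreDuChamp hG (G.heat hG t f) (G.laplacianCLM hG (G.heat hG t f)) +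
          (2 * K) • G.carreDuChamp hG (G.heat hG t f) (G.heat hG t f))) t := by
  have hexp : HasDerivAt (fun s => Real.exp (2 * K * s)) (Real.exp (2 * K * t) * (2 * K)) t := by
    simpa using ((hasDerivAt_id t).const_mul (2 * K)).exp
  refine (hexp.smul (G.hasDerivAt_carreDuChamp_heat hG f t)).congr_deriv ?_
  rw [mul_smul, smul_add]

theorem exp_mul_carreDuChamp_heat_apply_le {v : ℓ^∞(V, ℝ)} (hv : ∀ x, 0 ≤ v x)
    (hCD : G.CD (fun x => K - v x) ∞) (f : ℓ^∞(V, ℝ)) {M : ℝ} (ht : 0 ≤ t)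
    (hM : ∀ s ∈ Icc 0 t,
      Real.exp (2 * K * s) * ‖G.carreDuChamp hG (G.heat hG s f) (G.heat hG s f)‖ ≤ M) (x : V) :
    Real.exp (2 * K * t) * G.carreDuChamp hG (G.heat hG t f) (G.heat hG t f) x ≤
      G.heat hG t (G.carreDuChamp hG f f) x +
        2 * M * ∫ s in (0 : ℝ)..t, G.heat hG (t - s) v x := by
  have hsub : ∀ s ∈ Ioo 0 t, ∀ y, (Real.exp (2 * K * s) •
        ((2 : ℝ) • G.carreDuChamp hG (G.heat hG s f) (G.laplacianCLM hG (G.heat hG s f)) +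
          (2 * K) • G.carreDuChamp hG (G.heat hG s f) (G.heat hG s f))) y ≤
      G.laplacianCLM hG
          (Real.exp (2 * K * s) • G.carreDuChamp hG (G.heat hG s f) (G.heat hG s f)) y +
        ((2 * M) • v) y := by
    intro s hs y
    have hΓ : Real.exp (2 * K * s) * G.Gam (G.heat hG s f) (G.heat hG s f) y ≤ M :=
      (mul_le_mul_of_nonneg_left (apply_le_norm (G.carreDuChamp hG _ _) y)
        (Real.exp_pos _).le).trans (hM s (Ioo_subset_Icc_self hs))
    have hpot := mul_le_mul_of_nonneg_right hΓ (hv y)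
    have hcurv := mul_le_mul_of_nonneg_left
      (G.two_mul_Gam_laplacian_self_add_le hCD (G.heat hG s f) y) (Real.exp_pos (2 * K * s)).le
    rw [map_smul]
    change Real.exp (2 * K * s) * (2 * G.Gam _ (G.laplacian _) y + 2 * K * G.Gam _ _ y) ≤
      Real.exp (2 * K * s) * G.laplacian (G.Gam _ _) y + 2 * M * v y
    linarith
  simpa [heat_zero] using G.apply_le_heat_apply_add_integral hG ht
    (G.hasDerivAt_exp_smul_carreDuChamp_heat hG K f) continuous_const hsub x

theorem integral_heat_sub_apply_le (ht : 0 ≤ t) (v : ℓ^∞(V, ℝ)) (x : V) :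
    ∫ s in (0 : ℝ)..t, G.heat hG (t - s) v x ≤ ∫ s in (0 : ℝ)..t, ‖G.heat hG s v‖ := by
  have hcont : Continuous fun s => G.heat hG s v x :=
    (lp.evalCLM ℝ (fun _ : V => ℝ) ∞ x).continuous.comp
      ((G.continuous_heat hG).clm_apply continuous_const)
  rw [intervalIntegral.integral_comp_sub_left (fun s => G.heat hG s v x), sub_self, sub_zero]
  exact intervalIntegral.integral_mono_on ht (hcont.intervalIntegrable _ _)
    ((G.continuous_norm_heat_apply hG v).intervalIntegrable _ _) fun s _ => apply_le_norm _ x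

theorem exp_mul_norm_carreDuChamp_heat_le {v : ℓ^∞(V, ℝ)} (hv : ∀ x, 0 ≤ v x)
    (hCD : G.CD (fun x => K - v x) ∞) (f : ℓ^∞(V, ℝ)) {M : ℝ} (ht : 0 ≤ t)
    (hM : ∀ s ∈ Icc 0 t,
      Real.exp (2 * K * s) * ‖G.carreDuChamp hG (G.heat hG s f) (G.heat hG s f)‖ ≤ M) :
    Real.exp (2 * K * t) * ‖G.carreDuChamp hG (G.heat hG t f) (G.heat hG t f)‖ ≤
      ‖G.carreDuChamp hG f f‖ + 2 * M * ∫ s in (0 : ℝ)..t, ‖G.heat hG s v‖ := by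
  have hM₀ : 0 ≤ M := le_trans (by positivity) (hM 0 (left_mem_Icc.2 ht))
  have hintegral : 0 ≤ ∫ s in (0 : ℝ)..t, ‖G.heat hG s v‖ :=
    intervalIntegral.integral_nonneg ht fun s _ => norm_nonneg _
  rw [← le_div_iff₀' (Real.exp_pos _)]
  refine G.norm_carreDuChamp_self_le hG (by positivity) fun x => ?_
  rw [le_div_iff₀' (Real.exp_pos _)]
  refine (G.exp_mul_carreDuChamp_heat_apply_le hG hv hCD f ht hM x).trans ?_
  gcongr
  · exact G.heat_apply_le_norm hG ht _ x
  · exact G.integral_heat_sub_apply_le hG ht v x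

theorem exp_mul_norm_carreDuChamp_heat_le_div {v : ℓ^∞(V, ℝ)} (hv : ∀ x, 0 ≤ v x)
    (hCD : G.CD (fun x => K - v x) ∞)
    (hintegral : ∀ t ∈ Icc 0 T, ∫ s in (0 : ℝ)..t, ‖G.heat hG s v‖ ≤ β) (hβ : 2 * β < 1)
    (f : ℓ^∞(V, ℝ)) (ht : t ∈ Icc 0 T) :
    Real.exp (2 * K * t) * ‖G.carreDuChamp hG (G.heat hG t f) (G.heat hG t f)‖ ≤
      ‖G.carreDuChamp hG f f‖ / (1 - 2 * β) := by
  have hcont := G.continuous_norm_carreDuChamp_heat hG f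
  refine le_div_one_sub_of_forall_le_add_mul
    (φ := fun t => Real.exp (2 * K * t) * ‖G.carreDuChamp hG (G.heat hG t f) (G.heat hG t f)‖)
    (by fun_prop) hβ (fun r hr M hM => ?_) ht
  have hM₀ : 0 ≤ M := le_trans (by positivity) (hM 0 (left_mem_Icc.2 hr.1))
  linarith [G.exp_mul_norm_carreDuChamp_heat_le hG hv hCD f hr.1 hM,
    mul_le_mul_of_nonneg_left (hintegral r hr) hM₀]

theorem hasGradientDecay_of_integral_norm_heat_le {v : ℓ^∞(V, ℝ)} (hT : 0 < T) (hK : 0 ≤ K)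
    (hv : ∀ x, 0 ≤ v x) (hCD : G.CD (fun x => K - v x) ∞)
    (hintegral : ∀ t ∈ Icc 0 T,
      ∫ s in (0 : ℝ)..t, ‖G.heat hG s v‖ ≤ 1 / 2 * (1 - Real.exp (-(K * T)))) :
    G.HasGradientDecay hG (Real.exp (K * T)) K := by
  have hlocal (f : ℓ^∞(V, ℝ)) (t : ℝ) (ht : t ∈ Icc 0 T) :
      ‖G.carreDuChamp hG (G.heat hG t f) (G.heat hG t f)‖ ≤
        Real.exp (K * (T - 2 * t)) * ‖G.carreDuChamp hG f f‖ := by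
    have hone : 1 - 2 * (1 / 2 * (1 - Real.exp (-(K * T)))) = Real.exp (-(K * T)) := by ring
    have hdiv := G.exp_mul_norm_carreDuChamp_heat_le_div hG hv hCD hintegral
      (by linarith [Real.exp_pos (-(K * T))]) f ht
    rw [hone] at hdiv
    calc ‖G.carreDuChamp hG (G.heat hG t f) (G.heat hG t f)‖
        ≤ ‖G.carreDuChamp hG f f‖ / Real.exp (-(K * T)) / Real.exp (2 * K * t) :=
          (le_div_iff₀' (Real.exp_pos _)).2 hdiv
      _ = Real.exp (K * (T - 2 * t)) * ‖G.carreDuChamp hG f f‖ := by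
        rw [div_div, ← Real.exp_add, div_eq_mul_inv, ← Real.exp_neg, mul_comm]
        ring_nf
  intro f t ht
  rw [← Real.exp_add, ← sub_eq_add_neg, ← mul_sub]
  exact semigroup_le_exp_mul (S := fun t f => G.heat hG t f)
    (N := fun f => ‖G.carreDuChamp hG f f‖) (G.heat_add_apply hG) (fun _ => norm_nonneg _) hK hT
    hlocal f ht

theorem integral_norm_heat_trunc_le {W : V → ℝ≥0} (hβ : 0 ≤ β)
    (hW : G.katoConst hG T W ≤ ENNReal.ofReal β) (j : ℕ) (ht : t ∈ Icc 0 T) :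
    ∫ s in (0 : ℝ)..t, ‖G.heat hG s (trunc j W)‖ ≤ β := by
  have hcont := G.continuous_norm_heat_apply hG (trunc j W)
  rw [intervalIntegral.integral_of_le ht.1, ← ENNReal.ofReal_le_ofReal_iff hβ,
    MeasureTheory.ofReal_integral_eq_lintegral_ofReal hcont.integrableOn_Ioc
      (.of_forall fun s => norm_nonneg _)]
  simp only [ofReal_norm]
  calc ∫⁻ s in Ioc 0 t, ‖G.heat hG s (trunc j W)‖ₑ
      ≤ ∫⁻ s in Ioc 0 T, ‖G.heat hG s (trunc j W)‖ₑ :=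
        MeasureTheory.lintegral_mono_set (Ioc_subset_Ioc_right ht.2)
    _ ≤ G.katoConst hG T W :=
        le_iSup (fun j : ℕ => ∫⁻ s in Ioc 0 T, ‖G.heat hG s (trunc j W)‖ₑ) j
    _ ≤ ENNReal.ofReal β := hW

theorem hasGradientDecay_of_katoConst_le (hT : 0 < T) (hK : 0 ≤ K) {ρ : V → ℝ} {n : ℝ≥0∞}
    (hCD : G.CD ρ n) {W : V → ℝ≥0} (hW : ∀ x, K - W x ≤ ρ x)
    (hKato : G.katoConst hG T W ≤ ENNReal.ofReal (1 / 2 * (1 - Real.exp (-(K * T))))) :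
    G.HasGradientDecay hG (Real.exp (K * T)) K := by
  obtain ⟨j, hj⟩ := exists_nat_ge (G.degMax + K)
  have hβ : 0 ≤ 1 / 2 * (1 - Real.exp (-(K * T))) := by
    have hexp : Real.exp (-(K * T)) ≤ 1 := Real.exp_le_one_iff.2 (by nlinarith)
    linarith
  exact G.hasGradientDecay_of_integral_norm_heat_le hG hT hK
    (v := trunc j W) (fun x => le_min j.cast_nonneg (W x).coe_nonneg) (hCD.sub_trunc hG hW hj)
    fun t ht => G.integral_norm_heat_trunc_le hG hβ hKato j ht

end Kato

/-! ### The diameter bound -/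

namespace HasGradientDecay

variable {G hG} {A K : ℝ}

theorem norm_heat_sub_self_le (h : G.HasGradientDecay hG A K) (hK : 0 < K) (f : ℓ^∞(V, ℝ))
    (ht : 0 ≤ t) :
    ‖G.heat hG t f - f‖ ≤ √(2 * G.degMax * (A * ‖G.carreDuChamp hG f f‖)) / (K / 2) := by
  have hΔ : ∀ s, 0 ≤ s → ‖G.laplacianCLM hG (G.heat hG s f)‖ ≤
      √(2 * G.degMax * (A * ‖G.carreDuChamp hG f f‖)) * Real.exp (-(K / 2 * s)) := fun s hs => by
    have hD := G.degMax_nonneg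
    have hexp : Real.exp (-(K / 2 * s)) = √(Real.exp (-(K * s))) := by
      rw [← Real.exp_half]
      ring_nf
    rw [hexp, ← Real.sqrt_mul' _ (Real.exp_pos _).le]
    refine (G.norm_laplacianCLM_le_sqrt hG _).trans (Real.sqrt_le_sqrt ?_)
    refine (mul_le_mul_of_nonneg_left (h f s hs) (by positivity)).trans_eq ?_
    ring
  simpa [heat_zero] using norm_sub_le_div_of_norm_deriv_le_exp (Real.sqrt_nonneg _) (half_pos hK)
    (fun s _ => G.hasDerivAt_heat_apply hG f s) hΔ ht

theorem tendsto_Gam_heat (h : G.HasGradientDecay hG A K) (hK : 0 < K) (f : ℓ^∞(V, ℝ)) (x : V) :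
    Tendsto (fun t => G.Gam (G.heat hG t f) (G.heat hG t f) x) atTop (𝓝 0) := by
  have hexp : Tendsto (fun t => A * Real.exp (-(K * t)) * ‖G.carreDuChamp hG f f‖) atTop
      (𝓝 0) := by
    simpa using ((Real.tendsto_exp_neg_atTop_nhds_zero.comp
      (tendsto_id.const_mul_atTop hK)).const_mul A).mul_const ‖G.carreDuChamp hG f f‖
  refine squeeze_zero' (.of_forall fun t => G.Gam_self_nonneg _ x) ?_ hexp
  filter_upwards [eventually_ge_atTop 0] with t ht
  exact (apply_le_norm (G.carreDuChamp hG _ _) x).trans (h f t ht)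

theorem norm_heat_sub_self_le_of_abs_sub_le_one (h : G.HasGradientDecay hG A K) (hA : 0 ≤ A)
    (hK : 0 < K) {f : ℓ^∞(V, ℝ)} (hf : ∀ x y, 0 < G.w x y → |f y - f x| ≤ 1) (ht : 0 ≤ t) :
    ‖G.heat hG t f - f‖ ≤ 2 * G.degMax * √A / K := by
  have hD := G.degMax_nonneg
  have hΓ : ‖G.carreDuChamp hG f f‖ ≤ G.degMax / 2 :=
    G.norm_carreDuChamp_self_le hG (by positivity) fun z =>
      (G.Gam_self_le_deg_div_two hf z).trans (by gcongr; exact G.deg_le_degMax hG z)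
  calc ‖G.heat hG t f - f‖
      ≤ √(2 * G.degMax * (A * ‖G.carreDuChamp hG f f‖)) / (K / 2) :=
        h.norm_heat_sub_self_le hK f ht
    _ ≤ √(2 * G.degMax * (A * (G.degMax / 2))) / (K / 2) := by gcongr
    _ = √(G.degMax ^ 2 * A) / (K / 2) := by ring_nf
    _ = 2 * G.degMax * √A / K := by
      rw [Real.sqrt_mul (sq_nonneg _), Real.sqrt_sq hD]
      field_simp

theorem abs_sub_le (h : G.HasGradientDecay hG A K) (hA : 0 ≤ A) (hK : 0 < K) {f : ℓ^∞(V, ℝ)}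
    (hf : ∀ x y, 0 < G.w x y → |f y - f x| ≤ 1) (x y : V) :
    |f y - f x| ≤ 4 * G.degMax * √A / K := by
  have hlim : Tendsto (fun t => 4 * G.degMax * √A / K + |G.heat hG t f y - G.heat hG t f x|) atTop
      (𝓝 (4 * G.degMax * √A / K)) := by
    simpa using (G.tendsto_sub_of_tendsto_Gam (h.tendsto_Gam_heat hK f) x y).abs.const_add
      (4 * G.degMax * √A / K)
  refine ge_of_tendsto hlim ?_
  filter_upwards [eventually_ge_atTop 0] with t ht
  have hdisp (z : V) : |G.heat hG t f z - f z| ≤ 2 * G.degMax * √A / K :=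
    (abs_apply_le_norm (G.heat hG t f - f) z).trans
      (h.norm_heat_sub_self_le_of_abs_sub_le_one hA hK hf ht)
  calc |f y - f x|
      = |(G.heat hG t f x - f x) - (G.heat hG t f y - f y) +
          (G.heat hG t f y - G.heat hG t f x)| := by
        congr 1
        ring
    _ ≤ |G.heat hG t f x - f x| + |G.heat hG t f y - f y| +
          |G.heat hG t f y - G.heat hG t f x| :=
        (abs_add_le _ _).trans (add_le_add_left (abs_sub _ _) _)
    _ ≤ 2 * G.degMax * √A / K + 2 * G.degMax * √A / K +
          |G.heat hG t f y - G.heat hG t f x| := by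
        gcongr
        exacts [hdisp x, hdisp y]
    _ = 4 * G.degMax * √A / K + |G.heat hG t f y - G.heat hG t f x| := by ring

end HasGradientDecay

/-- The distance from `x₀`, truncated at height `N` to make it an element of `ℓ^∞(V)`; it tests the
gradient estimate. -/
noncomputable def truncDist (x₀ : V) (N : ℕ) : ℓ^∞(V, ℝ) :=
  toLinfty (fun x => (min (G.toSimpleGraph.dist x₀ x) N : ℕ)) N fun x => by
    rw [Nat.abs_cast]
    exact_mod_cast min_le_right _ _

variable {G hG} in
theorem HasGradientDecay.dist_le {A K : ℝ} (h : G.HasGradientDecay hG A K) (hA : 0 ≤ A)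
    (hK : 0 < K) (x y : V) : (G.toSimpleGraph.dist x y : ℝ) ≤ 4 * G.degMax * √A / K := by
  have htrunc := h.abs_sub_le hA hK (f := G.truncDist x (G.toSimpleGraph.dist x y))
    (fun a b hab => abs_min_dist_sub_min_dist_le_one hab x _) x y
  simpa [truncDist, toLinfty] using htrunc

end MWGraph

theorem one_fourth_mul_one_sub_exp_half_le {a : ℝ} (ha : 0 ≤ a) :
    1 / 4 * (1 - Real.exp (-(a / 2))) ≤ 1 / 2 * (1 - Real.exp (-a)) := by
  have hhalf : Real.exp (-(a / 2)) ≤ 1 := Real.exp_le_one_iff.2 (by linarith)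
  have hmono : Real.exp (-a) ≤ Real.exp (-(a / 2)) := Real.exp_le_exp.2 (by linarith)
  linarith

theorem mainTheorem3_general {V : Type*} (G : MWGraph V) (hG : G.BoundedDegree) (T K : ℝ)
    (hT : 0 < T) (hK : 0 < K) (ρ : V → ℝ) (hCD : G.CD ρ ∞)
    (hKato : G.katoConst hG T (fun x => ⟨(ρ x - K)⁻, negPart_nonneg _⟩) ≤
      ENNReal.ofReal (1 / 2 * (1 - Real.exp (-(K * T))))) :
    G.toSimpleGraph.ediam ≠ ⊤ ∧
      (G.toSimpleGraph.diam : ℝ) ≤ 4 * G.degMax * Real.exp (K * T / 2) / K := by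
  have hpot (x : V) : K - (ρ x - K)⁻ ≤ ρ x := by linarith [neg_le_negPart (ρ x - K)]
  have hdecay : G.HasGradientDecay hG (Real.exp (K * T)) K :=
    G.hasGradientDecay_of_katoConst_le hG hT hK.le hCD (W := fun x => ⟨(ρ x - K)⁻, _⟩) hpot hKato
  have hD := G.degMax_nonneg
  refine ediam_ne_top_and_diam_le_of_dist_le G.preconnected_toSimpleGraph (by positivity) ?_
  simpa only [Real.exp_half] using hdecay.dist_le (Real.exp_pos _).le hK

theorem mainTheorem3 {V : Type*} [Countable V] (G : MWGraph V) (hG : G.BoundedDegree)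
    (T K : ℝ) (hT : 0 < T) (hK : 0 < K) (n : ℝ≥0∞) (hn : 0 < n) (ρ : V → ℝ)
    (hCD : G.CD ρ n)
    (hKato : G.katoConst hG T (fun x => ⟨(ρ x - K)⁻, negPart_nonneg _⟩) ≤
      ENNReal.ofReal (1 / 4 * (1 - Real.exp (-(K * T / 2))))) :
    G.toSimpleGraph.ediam ≠ ⊤ ∧
      (G.toSimpleGraph.diam : ℝ) ≤ 4 * G.degMax * Real.exp (K * T / 2) / K :=
  mainTheorem3_general G hG T K hT hK ρ hCD.top <|
    hKato.trans (ENNReal.ofReal_le_ofReal (one_fourth_mul_one_sub_exp_half_le (by positivity)))
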